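/- **Definitions.** A map between topological spaces is *Baire-one* if it is the pointwise limit of a sequence of continuous maps. A space is *scattered* if each of its nonempty subsets has a relatively isolated point, and *hereditarily Baire* if each of its closed subspaces is a Baire space. A set is *functionally open* if it is the complement of the zero set of a continuous real function. A map $f$ from a topological space $X$ to a metric space is *functionally countably fragmented* if for every $\varepsilon>0$ there are a countable ordinal $\alpha$ and functionally open sets $\emptyset=U_0\subseteq U_1\subseteq\dots\subseteq U_\alpha=X$ (indexed by $\xi\in[0,\alpha]$) such that $U_\gamma=\bigcup_{\xi<\gamma}U_\xi$ for every limit ordinal $\gamma\le\alpha$ and $\operatorname{diam} f(U_{\xi+1}\setminus U_\xi)<\varepsilon$ for every $\xi<\alpha$. **Theorem.** There exist a completely regular (Hausdorff), scattered, hereditarily Baire space $X$ and a Baire-one function $f:X\to[0,1]$ such that $f$ is not functionally countably fragmented and there is no Baire-one function $g:\beta X\to\mathbb R$ with $g|_X=f$. In particular, a real-valued Baire-one function on a hereditarily Baire completely regular space $X$ need not extend to a Baire-one function on $\beta X$, which answers the question of Kalenda and Spurný in the negative. Moreover, $X$ and $f$ can be chosen of the following form. There are a map $\ell:X\to\omega_1$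 (the level), an injective map $q:X\to\mathbb Q\times[0,1]$ and a partial order on $X$ such that: 1. for each $\alpha<\omega_1$ the image $q(\ell^{-1}(\alpha))$ of the $\alpha$-th level is dense in $\mathbb Q\times[0,1]$; 2. $x<y$ implies $\ell(x)<\ell(y)$, and for all $x\in X$ and $\ell(x)\le\alpha<\omega_1$ there is exactly one $y\ge x$ with $\ell(y)=\alpha$; 3. for all $x\in X$ and $\beta<\ell(x)$ the set $\{q(y): y<x,\ \ell(y)=\beta\}$ is dense in $\mathbb Q\times[0,1]$; 4. with $L_{\le x}=\{y: y\le x\}$, the sets $q^{-1}(V)\cap\bigl(L_{\le x}\setminus\bigcup_{y\in Y}L_{\le y}\bigr)$, where $V$ is an open neighbourhood of $q(x)$ in $\mathbb Q\times[0,1]$ and $Y$ is a finite set of points $y<x$, form a base of neighbourhoods at every $x\in X$; 5. $f$ is the indicator function of the union of the even levels $\ell^{-1}(\alpha)$, where $\alpha=\lambda+n$ ($\lambda$ zero or a limit ordinal, $n<\omega$) is even if $n$ is even. -/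

import Mathlib

open Set Filter Topology

/-- A map is Baire-one if it is a pointwise limit of a sequence of continuous maps. -/
def IsBaireOne {X Y : Type*} [TopologicalSpace X] [TopologicalSpace Y] (f : X → Y) : Prop :=
  ∃ F : ℕ → X → Y, (∀ n, Continuous (F n)) ∧ ∀ x, Tendsto (fun n => F n x) atTop (𝓝 (f x))

/-- A topological space is scattered if every nonempty subset has a relatively isolated point. -/
def IsScattered (X : Type*) [TopologicalSpace X] : Prop :=
  ∀ E : Set X, E.Nonempty → ∃ x ∈ E, ∃ U : Set X, IsOpen U ∧ U ∩ E = {x}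

/-- A topological space is hereditarily Baire if every closed subspace is a Baire space. -/
def IsHereditarilyBaire (X : Type*) [TopologicalSpace X] : Prop :=
  ∀ F : Set X, IsClosed F → BaireSpace F

/-- A functionally open set: the complement of the zero set of a continuous real function. -/
def IsFunctionallyOpen {X : Type*} [TopologicalSpace X] (U : Set X) : Prop :=
  ∃ φ : X → ℝ, Continuous φ ∧ U = {x | φ x ≠ 0}

/-- The transfinite sequence `(U ξ : ξ ∈ [0, α])` is regular: it is an increasing, continuous
sequence of open sets from `∅` to the whole space. Values of `U` beyond `α` play no role. -/
structure IsRegularSeq {X : Type*} [TopologicalSpace X] (α : Ordinal.{0})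
    (U : Ordinal.{0} → Set X) : Prop where
  isOpen : ∀ ξ ≤ α, IsOpen (U ξ)
  zero : U 0 = ∅
  last : U α = univ
  mono : ∀ ξ η, ξ ≤ η → η ≤ α → U ξ ⊆ U η
  limit : ∀ γ ≤ α, Order.IsSuccLimit γ → U γ = ⋃ ξ < γ, U ξ

/-- The regular sequence `(U ξ : ξ ∈ [0, α])` is `ε`-associated with `f`. The diameter is the
extended one, so that unbounded sets have infinite diameter. -/
def IsAssociatedSeq {X Y : Type*} [TopologicalSpace X] [MetricSpace Y] (f : X → Y) (ε : ℝ)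
    (α : Ordinal.{0}) (U : Ordinal.{0} → Set X) : Prop :=
  IsRegularSeq α U ∧
    ∀ ξ < α, Metric.ediam (f '' (U (Order.succ ξ) \ U ξ)) < ENNReal.ofReal ε

/-- `f` is functionally countably fragmented: for every `ε > 0` it has an `ε`-associated sequence
of functionally open sets that is indexed by a countable ordinal. -/
def IsFunctionallyCountablyFragmented {X Y : Type*} [TopologicalSpace X] [MetricSpace Y]
    (f : X → Y) : Prop :=
  ∀ ε : ℝ, 0 < ε → ∃ (α : Ordinal.{0}) (U : Ordinal.{0} → Set X),
    α < Ordinal.omega 1 ∧ IsAssociatedSeq f ε α U ∧ ∀ ξ ≤ α, IsFunctionallyOpen (U ξ)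

/-- `X` is made of `ω₁` levels, which `q` identifies with pairwise disjoint dense subsets of
`ℚ × [0, 1]`, and carries a tree order (larger points lie on higher levels) together with the
corresponding tree topology. The sets `Set.Iic x` are the cones below the points `x`. -/
structure IsLevelTree (X : Type*) [TopologicalSpace X] [PartialOrder X]
    (level : X → Ordinal.{0}) (q : X → ℚ × unitInterval) : Prop where
  level_lt : ∀ x, level x < Ordinal.omega 1
  injective : Function.Injective q
  dense_level : ∀ α < Ordinal.omega 1, Dense (q '' {x | level x = α})
  strictMono : StrictMono level
  existsUnique_above : ∀ x, ∀ α < Ordinal.omega 1, level x ≤ α → ∃! y, x ≤ y ∧ level y = α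
  dense_below : ∀ x, ∀ β < level x, Dense (q '' {y | y < x ∧ level y = β})
  /-- A base of neighbourhoods at `x`: points of the cone below `x` that `q` maps into a given
  neighbourhood of `q x`, with finitely many cones below points `y < x` removed. -/
  nhds_basis : ∀ x, (𝓝 x).HasBasis
    (fun s : Set (ℚ × unitInterval) × Set X =>
      IsOpen s.1 ∧ q x ∈ s.1 ∧ s.2.Finite ∧ s.2 ⊆ Iio x)
    (fun s => q ⁻¹' s.1 ∩ (Iic x \ ⋃ y ∈ s.2, Iic y))

/-! The engine is `exists_mem_level_eq`: in a level tree, every neighbourhood of a point meets every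
lower level.

No fragmentation: by induction `U ξ` contains only points of level below `ξ`. Otherwise `U (succ ξ)`
would contain points of levels `ξ` and `succ ξ`, both outside `U ξ`, where `f` takes the values 0
and 1. So no countable sequence exhausts the `ω₁` levels; openness of the `U ξ` suffices.

No extension: if continuous `G n` on `βX` converge to an extension, they map `βX` onto a compact set
in `ℕ → ℝ`. By second countability the closures of the images of the final segments of levels
stabilise before `ω₁`. In the stable compact set the images of an even and of an odd level are both
dense, while the coordinates converge pointwise everywhere, to 1 on one and to 0 on the other. This
contradicts the Baire category theorem.

Existence: finitely supported functions on final segments of `ω₁`, ordered by restriction, form the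
tree. The labelling makes the parity of the level readable from the rational coordinate, so `f`
factors continuously through `ℚ`, where every function is Baire-one. -/

theorem Ordinal.mod_two_eq_zero_or_one (a : Ordinal.{0}) : a % 2 = 0 ∨ a % 2 = 1 := by
  have h : a % 2 < Order.succ 1 := by
    rw [Order.succ_eq_add_one, one_add_one_eq_two]
    exact Ordinal.mod_lt a two_ne_zero
  rcases (Order.lt_succ_iff.1 h).lt_or_eq with h | h
  · exact Or.inl (Order.lt_one_iff.1 h)
  · exact Or.inr h

theorem Ordinal.succ_mod_two_eq_zero_iff (a : Ordinal.{0}) :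
    Order.succ a % 2 = 0 ↔ ¬ a % 2 = 0 := by
  have key : Order.succ a = 2 * (a / 2) + (a % 2 + 1) := by
    rw [← add_assoc, Ordinal.div_add_mod, Order.succ_eq_add_one]
  have h12 : (1 : Ordinal.{0}) < 2 := by
    rw [← one_add_one_eq_two, ← Order.succ_eq_add_one]; exact Order.lt_succ 1
  rcases a.mod_two_eq_zero_or_one with h | h
  · rw [key, h, zero_add, Ordinal.mul_add_mod_self, Ordinal.mod_eq_of_lt h12]
    simp
  · rw [key, h, one_add_one_eq_two, Ordinal.mul_add_mod_self, Ordinal.mod_self]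
    simp

theorem Rat.nhdsNE_prod_neBot {Z : Type*} [TopologicalSpace Z] (a : ℚ × Z) :
    (𝓝[≠] a).NeBot := by
  have h : Tendsto (fun r : ℚ => (r, a.2)) (𝓝[≠] a.1) (𝓝[≠] a) := by
    refine tendsto_nhdsWithin_iff.2 ⟨?_, ?_⟩
    · have : Continuous fun r : ℚ => (r, a.2) := by fun_prop
      exact (this.tendsto a.1).mono_left nhdsWithin_le_nhds
    · filter_upwards [self_mem_nhdsWithin] with r hr h
      exact hr (congrArg Prod.fst h)
  have : (𝓝[≠] a.1).NeBot := (inferInstance : (𝓝[>] a.1).NeBot).mono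
    (nhdsWithin_mono _ fun _ h => ne_of_gt h)
  exact h.neBot

/-! ### Scattered spaces, Baire category and Baire-one functions -/

/-- In a scattered space the isolated points are dense, so that it is a Baire space. -/
theorem IsScattered.baireSpace {X : Type*} [TopologicalSpace X] (h : IsScattered X) :
    BaireSpace X := by
  refine ⟨fun f _ hf => ?_⟩
  rw [dense_iff_inter_open]
  intro U hU hne
  obtain ⟨x, hx, V, hV, hVU⟩ := h U hne
  refine ⟨x, hx, mem_iInter.2 fun n => ?_⟩
  obtain ⟨y, hy, hyf⟩ := (hf n).inter_open_nonempty _ (hV.inter hU) (by rw [hVU]; simp)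
  rw [hVU] at hy
  rwa [← mem_singleton_iff.1 hy]

theorem IsScattered.subtype {X : Type*} [TopologicalSpace X] (h : IsScattered X) (F : Set X) :
    IsScattered F := by
  intro E hE
  obtain ⟨_, ⟨x, hx, rfl⟩, U, hU, hUE⟩ := h (Subtype.val '' E) (hE.image _)
  refine ⟨x, hx, Subtype.val ⁻¹' U, hU.preimage continuous_subtype_val, ?_⟩
  ext y
  have := Set.ext_iff.1 hUE y
  simpa [Subtype.ext_iff] using this

theorem IsScattered.isHereditarilyBaire {X : Type*} [TopologicalSpace X] (h : IsScattered X) :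
    IsHereditarilyBaire X := fun F _ => (h.subtype F).baireSpace

/-- If the restriction of a pointwise convergent sequence of continuous functions to a nonempty
compact set is `0` in the limit on one dense set and `1` on another, we get a contradiction. -/
theorem IsCompact.false_of_tendsto_zero_one {L : Type*} [TopologicalSpace L] [T2Space L]
    {K : Set L} (hK : IsCompact K) (hne : K.Nonempty) {π : ℕ → L → ℝ} (hπ : ∀ n, Continuous (π n))
    (hlim : ∀ y ∈ K, ∃ l, Tendsto (fun n => π n y) atTop (𝓝 l)) {A B : Set L}
    (hA : K ⊆ closure A) (hB : K ⊆ closure B) (hAK : A ⊆ K) (hBK : B ⊆ K)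
    (h0 : ∀ y ∈ A, Tendsto (fun n => π n y) atTop (𝓝 0))
    (h1 : ∀ y ∈ B, Tendsto (fun n => π n y) atTop (𝓝 1)) : False := by
  have : CompactSpace K := isCompact_iff_compactSpace.1 hK
  have : Nonempty K := hne.to_subtype
  let C : ℕ → Set K := fun N => {y | ∀ m, N ≤ m → |π m y - π N y| ≤ 1 / 4}
  have hC : ∀ N, IsClosed (C N) := by
    intro N
    simp only [C, ofPred_forall]
    refine isClosed_iInter fun m => isClosed_iInter fun _ => isClosed_le ?_ continuous_const
    exact (((hπ m).comp continuous_subtype_val).sub ((hπ N).comp continuous_subtype_val)).abs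
  have hU : ⋃ N, C N = univ := by
    refine eq_univ_of_forall fun y => ?_
    obtain ⟨l, hl⟩ := hlim y y.2
    obtain ⟨N, hN⟩ := Metric.cauchySeq_iff'.1 hl.cauchySeq (1 / 4) (by norm_num)
    exact mem_iUnion.2 ⟨N, fun m hm => by
      have := hN m hm
      rw [Real.dist_eq] at this
      exact this.le⟩
  obtain ⟨N, y, hy⟩ := nonempty_interior_of_iUnion_of_closed hC hU
  obtain ⟨V, hV, hVC⟩ := isOpen_induced_iff.1 (isOpen_interior (s := C N))
  have hyV : (y : L) ∈ V := by
    have : y ∈ Subtype.val ⁻¹' V := hVC ▸ hy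
    exact this
  have hmem : ∀ z ∈ K, z ∈ V → ∀ m, N ≤ m → |π m z - π N z| ≤ 1 / 4 := by
    intro z hz hzV
    have : (⟨z, hz⟩ : K) ∈ interior (C N) := hVC ▸ (show z ∈ V from hzV)
    exact interior_subset this
  have hlimN : ∀ z ∈ K, z ∈ V → ∀ l, Tendsto (fun n => π n z) atTop (𝓝 l) →
      |l - π N z| ≤ 1 / 4 := fun z hz hzV l hl =>
    le_of_tendsto (hl.sub_const _).abs (eventually_atTop.2 ⟨N, hmem z hz hzV⟩)
  -- On this set any two limits differ by at most `2 * (1 / 4 + 1 / 8) < 1`, too little for 0 and 1.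
  have hW : IsOpen (V ∩ {z | |π N z - π N y| < 1 / 8}) :=
    hV.inter (isOpen_lt (((hπ N).sub continuous_const).abs) continuous_const)
  have hyW : (y : L) ∈ V ∩ {z | |π N z - π N y| < 1 / 8} := ⟨hyV, by simp⟩
  obtain ⟨a, ⟨haV, ha⟩, haA⟩ := mem_closure_iff.1 (hA y.2) _ hW hyW
  obtain ⟨b, ⟨hbV, hb⟩, hbB⟩ := mem_closure_iff.1 (hB y.2) _ hW hyW
  have e0 := abs_le.1 (hlimN a (hAK haA) haV 0 (h0 a haA))
  have e1 := abs_le.1 (hlimN b (hBK hbB) hbV 1 (h1 b hbB))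
  have ea := abs_lt.1 (show |π N a - π N y| < 1 / 8 from ha)
  have eb := abs_lt.1 (show |π N b - π N y| < 1 / 8 from hb)
  linarith [e0.1, e0.2, e1.1, e1.2, ea.1, ea.2, eb.1, eb.2]

/-- Every function on `ℚ` is the pointwise limit of locally constant functions. -/
theorem Rat.isBaireOne {Y : Type*} [TopologicalSpace Y] (h : ℚ → Y) : IsBaireOne h := by
  classical
  obtain ⟨e, he⟩ := exists_surjective_nat ℚ
  have key : ∀ n : ℕ, ∃ g : ℚ → Y, Continuous g ∧ ∀ i < n, g (e i) = h (e i) := by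
    intro n
    induction n with
    | zero => exact ⟨fun _ => h 0, continuous_const, by simp⟩
    | succ n ih =>
      obtain ⟨g, hg, hgi⟩ := ih
      -- The next approximant changes `g` only on a clopen neighbourhood of `e n` that avoids the
      -- earlier points; `e` may repeat values, so `e n` itself is excluded from them.
      have hfin : ({r | ∃ i < n, e i = r} \ {e n}).Finite :=
        ((finite_lt_nat n).image e).subset (by rintro _ ⟨⟨i, hi, rfl⟩, -⟩; exact ⟨i, hi, rfl⟩)
      obtain ⟨C, hC, hen, hCs⟩ : ∃ C : Set ℚ, IsClopen C ∧ e n ∈ C ∧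
          C ⊆ ({r | ∃ i < n, e i = r} \ {e n})ᶜ := by
        have hsep : ∀ s : ℚ, ∃ C : Set ℚ, IsClopen C ∧ e n ∈ C ∧ (s ≠ e n → s ∉ C) := by
          intro s
          by_cases hs : s = e n
          · exact ⟨univ, isClopen_univ, trivial, fun h' => absurd hs h'⟩
          · obtain ⟨C, hC, h1, h2⟩ := exists_isClopen_of_totally_separated (Ne.symm hs)
            exact ⟨C, hC, h1, fun _ => h2⟩
        choose D hD hD1 hD2 using hsep
        exact ⟨_, hfin.isClopen_biInter fun s _ => hD s, mem_iInter₂.2 fun s _ => hD1 s,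
          fun s hs hs' => hD2 s hs'.2 (mem_iInter₂.1 hs s hs')⟩
      refine ⟨C.piecewise (fun _ => h (e n)) g, ?_, fun i hi => ?_⟩
      · refine continuous_piecewise (by simp [hC.frontier_eq]) continuous_const.continuousOn
          hg.continuousOn
      · by_cases h1 : e i = e n
        · rw [h1, piecewise_eq_of_mem _ _ _ hen]
        · have hin : i < n := lt_of_le_of_ne (Nat.lt_succ_iff.1 hi) (by rintro rfl; exact h1 rfl)
          rw [piecewise_eq_of_notMem _ _ _ fun hc => hCs hc ⟨⟨i, hin, rfl⟩, h1⟩, hgi i hin]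
  choose g hg hgi using key
  refine ⟨g, hg, fun r => ?_⟩
  obtain ⟨i, rfl⟩ := he r
  exact tendsto_const_nhds.congr' (eventually_atTop.2 ⟨i + 1, fun n hn => (hgi n i hn).symm⟩)

theorem IsBaireOne.comp_continuous {X Y Z : Type*} [TopologicalSpace X] [TopologicalSpace Y]
    [TopologicalSpace Z] {g : Y → Z} (hg : IsBaireOne g) {φ : X → Y} (hφ : Continuous φ) :
    IsBaireOne (g ∘ φ) := by
  obtain ⟨G, hG, hl⟩ := hg
  exact ⟨fun n => G n ∘ φ, fun n => (hG n).comp hφ, fun x => hl (φ x)⟩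

/-! ### Topology of level trees and the two negative results -/

namespace IsLevelTree

variable {X : Type*} [TopologicalSpace X] [PartialOrder X] {level : X → Ordinal.{0}}
  {q : X → ℚ × unitInterval}

/-- The point above `w` on a given level is unique, so climbing from the lower of `x`, `y` to the
level of the other must arrive there. -/
theorem le_or_le (h : IsLevelTree X level q) {w x y : X} (hx : w ≤ x) (hy : w ≤ y) :
    x ≤ y ∨ y ≤ x := by
  wlog hl : level x ≤ level y generalizing x y
  · exact (this hy hx (le_of_not_ge hl)).symm
  obtain ⟨z, ⟨hxz, hz⟩, -⟩ := h.existsUnique_above x (level y) (h.level_lt y) hl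
  have : z = y := (h.existsUnique_above w (level y) (h.level_lt y)
    (h.strictMono.monotone hy)).unique ⟨hx.trans hxz, hz⟩ ⟨hy, rfl⟩
  exact Or.inl (this ▸ hxz)

theorem exists_level_eq (h : IsLevelTree X level q) {β : Ordinal.{0}} (hβ : β < Ordinal.omega 1) :
    ∃ x, level x = β := by
  obtain ⟨_, x, hx, -⟩ := (h.dense_level β hβ).nonempty
  exact ⟨x, hx⟩

theorem Iic_mem_nhds (h : IsLevelTree X level q) (x : X) : Iic x ∈ 𝓝 x :=
  (h.nhds_basis x).mem_iff.2 ⟨(univ, ∅), ⟨isOpen_univ, trivial, finite_empty, empty_subset _⟩,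
    fun _ hz => hz.2.1⟩

theorem isOpen_Iic (h : IsLevelTree X level q) (x : X) : IsOpen (Iic x) :=
  isOpen_iff_mem_nhds.2 fun y hy => mem_of_superset (h.Iic_mem_nhds y) (Iic_subset_Iic.2 hy)

/-- A point of minimal level in a set is isolated in it by its open cone. -/
theorem isScattered (h : IsLevelTree X level q) : IsScattered X := by
  intro E hE
  obtain ⟨x, hx, hmin⟩ := (InvImage.wf level Ordinal.lt_wf).has_min E hE
  refine ⟨x, hx, Iic x, h.isOpen_Iic x, ?_⟩
  ext y
  refine ⟨fun ⟨hyx, hy⟩ => ?_, by rintro rfl; exact ⟨le_rfl, hx⟩⟩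
  exact (eq_or_lt_of_le hyx).resolve_right fun hlt => hmin y hy (h.strictMono hlt)

/-- Every neighbourhood of a point meets every lower level. -/
theorem exists_mem_level_eq (h : IsLevelTree X level q) {x : X} {U : Set X} (hU : U ∈ 𝓝 x)
    {β : Ordinal.{0}} (hβ : β ≤ level x) : ∃ z ∈ U, level z = β := by
  rcases hβ.eq_or_lt with rfl | hβ
  · exact ⟨x, mem_of_mem_nhds hU, rfl⟩
  obtain ⟨⟨V, Y⟩, ⟨hV, hxV, hY, hYx⟩, hsub⟩ := (h.nhds_basis x).mem_iff.1 hU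
  simp only at hV hxV hY hYx hsub
  have := Rat.nhdsNE_prod_neBot (Z := unitInterval)
  obtain ⟨γ, hβγ, hYγ, hγx⟩ : ∃ γ, β ≤ γ ∧ (∀ y ∈ Y, level y ≤ γ) ∧ γ < level x := by
    have hfin : (insert β (level '' Y)).Finite := (hY.image level).insert β
    obtain ⟨γ, hγ, hmax⟩ := hfin.exists_maximalFor id _ (insert_nonempty _ _)
    have hmax' : ∀ δ ∈ insert β (level '' Y), δ ≤ γ := fun δ hδ =>
      (le_total δ γ).elim id fun h' => hmax hδ h'
    refine ⟨γ, hmax' _ (mem_insert _ _), fun y hy => hmax' _ (Or.inr ⟨y, hy, rfl⟩), ?_⟩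
    rcases hγ with rfl | ⟨y, hy, rfl⟩
    · exact hβ
    · exact h.strictMono (hYx hy)
  -- Each `y ∈ Y` has only one point above it on level `γ`. Discarding these finitely many points
  -- preserves density, as `ℚ × [0, 1]` has no isolated points.
  have hbad : {z | level z = γ ∧ ∃ y ∈ Y, y ≤ z}.Finite := by
    have : {z | level z = γ ∧ ∃ y ∈ Y, y ≤ z} = ⋃ y ∈ Y, {z | y ≤ z ∧ level z = γ} := by
      ext z; simp only [mem_ofPred_eq, mem_iUnion]; tauto
    rw [this]
    refine hY.biUnion fun y hy => Subsingleton.finite fun z hz z' hz' => ?_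
    exact (h.existsUnique_above y γ (hγx.trans (h.level_lt x)) (hYγ y hy)).unique hz hz'
  obtain ⟨_, hzV, ⟨z, ⟨hzx, hz⟩, rfl⟩, hzb⟩ :=
    ((h.dense_below x γ hγx).sdiff_finite (hbad.image q)).inter_open_nonempty V hV ⟨_, hxV⟩
  have hzY : ∀ y ∈ Y, ¬ y ≤ z := fun y hy hyz => hzb ⟨z, ⟨hz, y, hy, hyz⟩, rfl⟩
  -- The cone of `z` is disjoint from the removed cones: a common point would make `z` comparable
  -- with some `y ∈ Y`, and `z` is neither above `y` nor on a lower level.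
  have hcone : ∀ w ≤ z, q w ∈ V → w ∈ U := by
    refine fun w hwz hw => hsub ⟨hw, hwz.trans hzx.le, ?_⟩
    simp only [mem_iUnion, not_exists]
    intro y hy hwy
    rcases h.le_or_le hwy hwz with hyz | hzy
    · exact hzY y hy hyz
    · rcases hzy.eq_or_lt with rfl | hlt
      · exact hzY z hy le_rfl
      · exact (h.strictMono hlt).not_ge (hz ▸ hYγ y hy)
  rcases hβγ.eq_or_lt with rfl | hβγ
  · exact ⟨z, hcone z le_rfl hzV, hz⟩
  · obtain ⟨_, hwV, w, ⟨hwz, hw⟩, rfl⟩ :=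
      (h.dense_below z β (hz ▸ hβγ)).inter_open_nonempty V hV ⟨_, hxV⟩
    exact ⟨w, hcone w hwz.le hwV, hw⟩

theorem not_isFunctionallyCountablyFragmented (h : IsLevelTree X level q) {f : X → unitInterval}
    (hf : ∀ x, (f x : ℝ) = indicator {z | level z % 2 = 0} (fun _ => (1 : ℝ)) x) :
    ¬ IsFunctionallyCountablyFragmented f := by
  intro hfrag
  obtain ⟨α, U, hα, ⟨hreg, hdiam⟩, -⟩ := hfrag 1 one_pos
  have key : ∀ ξ, ξ ≤ α → ∀ x ∈ U ξ, level x < ξ := by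
    intro ξ
    induction ξ using Ordinal.limitRecOn with
    | zero =>
      intro _ x hx
      rw [hreg.zero] at hx
      exact hx.elim
    | add_one ξ ih =>
      rw [← Order.succ_eq_add_one]
      intro hξ x hx
      have hlt : ξ < α := (Order.lt_succ ξ).trans_le hξ
      by_contra! hle
      have hUx : U (Order.succ ξ) ∈ 𝓝 x := (hreg.isOpen _ hξ).mem_nhds hx
      obtain ⟨y, hy, hyl⟩ := h.exists_mem_level_eq hUx ((Order.le_succ ξ).trans hle)
      obtain ⟨z, hz, hzl⟩ := h.exists_mem_level_eq hUx hle
      have hyU : y ∉ U ξ := fun hy' => (ih hlt.le y hy').ne hyl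
      have hzU : z ∉ U ξ := fun hz' =>
        ((Order.lt_succ ξ).trans_eq hzl.symm).not_gt (ih hlt.le z hz')
      have h1 := (Metric.edist_le_ediam_of_mem (mem_image_of_mem f (show y ∈ U (Order.succ ξ) \ U ξ from ⟨hy, hyU⟩))
        (mem_image_of_mem f (show z ∈ U (Order.succ ξ) \ U ξ from ⟨hz, hzU⟩))).trans_lt (hdiam ξ hlt)
      rw [edist_dist, ENNReal.ofReal_lt_ofReal_iff one_pos, Subtype.dist_eq, hf, hf,
        Real.dist_eq] at h1
      have hpar := Ordinal.succ_mod_two_eq_zero_iff ξ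
      by_cases h0 : ξ % 2 = 0
      · have h0' : ¬ Order.succ ξ % 2 = 0 := fun h' => hpar.1 h' h0
        rw [indicator_of_mem (by simpa [hyl] using h0),
          indicator_of_notMem (by simpa [hzl] using h0')] at h1
        norm_num at h1
      · rw [indicator_of_notMem (by simpa [hyl] using h0),
          indicator_of_mem (show z ∈ {z | level z % 2 = 0} by simpa [hzl] using hpar.2 h0)] at h1
        norm_num at h1
    | limit ξ hlim ih =>
      intro hξ x hx
      rw [hreg.limit ξ hξ hlim] at hx
      simp only [mem_iUnion] at hx
      obtain ⟨η, hη, hx⟩ := hx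
      exact (ih η hη (hη.le.trans hξ) x hx).trans hη
  obtain ⟨x, hx⟩ := h.exists_level_eq hα
  exact (key α le_rfl x (hreg.last ▸ mem_univ x)).ne hx

theorem not_exists_extension (h : IsLevelTree X level q) {f : X → unitInterval}
    (hf : ∀ x, (f x : ℝ) = indicator {z | level z % 2 = 0} (fun _ => (1 : ℝ)) x) :
    ¬ ∃ g : StoneCech X → ℝ, IsBaireOne g ∧ ∀ x, g (stoneCechUnit x) = (f x : ℝ) := by
  rintro ⟨g, ⟨G, hG, hlim⟩, hgf⟩
  let Φ : StoneCech X → ℕ → ℝ := fun p n => G n p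
  have hΦ : Continuous Φ := continuous_pi hG
  let A : Ordinal.{0} → Set (ℕ → ℝ) := fun β => (fun x => Φ (stoneCechUnit x)) '' {x | β ≤ level x}
  have hΦX : Continuous fun x : X => Φ (stoneCechUnit x) := hΦ.comp continuous_stoneCechUnit
  obtain ⟨b, hbc, -, hb⟩ := TopologicalSpace.exists_countable_basis (ℕ → ℝ)
  -- A basic set that misses some `A β` misses all later ones; countably many such `β` have a
  -- supremum below `ω₁`.
  have hstab : ∃ α < Ordinal.omega 1, ∀ V ∈ b, (V ∩ A α).Nonempty →
      ∀ β < Ordinal.omega 1, (V ∩ A β).Nonempty := by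
    have : Countable b := hbc.to_subtype
    have hex : ∀ V : b, ∃ α < Ordinal.omega 1, (V.1 ∩ A α).Nonempty →
        ∀ β < Ordinal.omega 1, (V.1 ∩ A β).Nonempty := by
      intro V
      by_cases hV : ∀ β < Ordinal.omega 1, (V.1 ∩ A β).Nonempty
      · exact ⟨0, Ordinal.omega_pos 1, fun _ => hV⟩
      · push Not at hV
        obtain ⟨α, hα, hVα⟩ := hV
        exact ⟨α, hα, fun hne => absurd hVα hne.ne_empty⟩
    choose a ha ha' using hex
    refine ⟨⨆ V, a V, Ordinal.iSup_lt_omega_one ha, fun V hV hne => ha' ⟨V, hV⟩ (hne.mono ?_)⟩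
    refine inter_subset_inter_right _ (image_mono fun x hx => ?_)
    exact (Ordinal.le_iSup a ⟨V, hV⟩).trans hx
  obtain ⟨α, hα, hstab⟩ := hstab
  have hsucc : ∀ β < Ordinal.omega 1, Order.succ β < Ordinal.omega 1 := fun β hβ =>
    (Cardinal.isSuccLimit_omega 1).succ_lt hβ
  have hdense : ∀ β < Ordinal.omega 1,
      closure (A α) ⊆ closure ((fun x => Φ (stoneCechUnit x)) '' {x | level x = β}) := by
    intro β hβ y hy
    rw [hb.mem_closure_iff] at hy ⊢
    intro V hV hyV
    obtain ⟨_, hxV, x, hx, rfl⟩ := hstab V hV (hy V hV hyV) β hβ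
    obtain ⟨z, hz, hzl⟩ := h.exists_mem_level_eq
      (hΦX.continuousAt.preimage_mem_nhds ((hb.isOpen hV).mem_nhds hxV)) hx
    exact ⟨_, hz, z, hzl, rfl⟩
  have hrange : closure (A α) ⊆ range Φ :=
    closure_minimal (by rintro _ ⟨x, -, rfl⟩; exact ⟨_, rfl⟩) (isCompact_range hΦ).isClosed
  have hKc : IsCompact (closure (A α)) :=
    (isCompact_range hΦ).of_isClosed_subset isClosed_closure hrange
  have hne : (closure (A α)).Nonempty := by
    obtain ⟨x, hx⟩ := h.exists_level_eq hα
    exact ⟨_, subset_closure ⟨x, hx.ge, rfl⟩⟩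
  have hsub : ∀ β, α ≤ β →
      (fun x => Φ (stoneCechUnit x)) '' {x | level x = β} ⊆ closure (A α) := fun β hβ =>
    (image_mono fun x (hx : level x = β) => hβ.trans hx.ge).trans subset_closure
  have hpar : ∃ β γ, α ≤ β ∧ β < Ordinal.omega 1 ∧ α ≤ γ ∧ γ < Ordinal.omega 1 ∧
      ¬ β % 2 = 0 ∧ γ % 2 = 0 := by
    by_cases h0 : α % 2 = 0
    · exact ⟨Order.succ α, α, Order.le_succ α, hsucc α hα, le_rfl, hα,
        fun h' => (Ordinal.succ_mod_two_eq_zero_iff α).1 h' h0, h0⟩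
    · exact ⟨α, Order.succ α, le_rfl, hα, Order.le_succ α, hsucc α hα, h0,
        (Ordinal.succ_mod_two_eq_zero_iff α).2 h0⟩
  obtain ⟨β, γ, hαβ, hβ, hαγ, hγ, hβ0, hγ0⟩ := hpar
  refine hKc.false_of_tendsto_zero_one hne (fun n => continuous_apply n) ?_ (hdense β hβ)
    (hdense γ hγ) (hsub β hαβ) (hsub γ hαγ) ?_ ?_
  · intro y hy
    obtain ⟨p, rfl⟩ := hrange hy
    exact ⟨g p, hlim p⟩
  · rintro _ ⟨x, hx, rfl⟩
    have hx' : x ∉ {z | level z % 2 = 0} := by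
      rw [mem_ofPred_eq, show level x = β from hx]
      exact hβ0
    have hl := hlim (stoneCechUnit x)
    rwa [hgf, hf, indicator_of_notMem hx'] at hl
  · rintro _ ⟨x, hx, rfl⟩
    have hx' : x ∈ {z | level z % 2 = 0} := by
      rw [mem_ofPred_eq, show level x = γ from hx]
      exact hγ0
    have hl := hlim (stoneCechUnit x)
    rwa [hgf, hf, indicator_of_mem hx'] at hl

end IsLevelTree

/-! ### Dense sets for the labels -/

/-- The rationals with odd denominator. -/
def oddDenominators : AddSubgroup ℚ where
  carrier := {r | Odd r.den}
  zero_mem' := by simp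
  add_mem' {a b} ha hb := (Odd.mul ha hb).of_dvd_nat (Rat.add_den_dvd a b)
  neg_mem' {a} ha := by simpa using ha

theorem dense_oddDenominators : Dense (oddDenominators : Set ℚ) := by
  refine oddDenominators.dense_of_not_isolated_zero fun ε hε => ?_
  obtain ⟨n, hn⟩ := exists_nat_gt ε⁻¹
  refine ⟨((2 * n + 1 : ℕ) : ℚ)⁻¹, ?_, by positivity, ?_⟩
  · change Odd (((2 * n + 1 : ℕ) : ℚ)⁻¹).den
    rw [Rat.inv_natCast_den_of_pos (by positivity)]
    exact odd_two_mul_add_one n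
  · rw [inv_lt_comm₀ (by positivity) hε]
    push_cast
    linarith [inv_pos.2 hε]

theorem dense_compl_oddDenominators : Dense (oddDenominators : Set ℚ)ᶜ := by
  have h2 : (1 / 2 : ℚ) ∉ oddDenominators := by
    change ¬ Odd (1 / 2 : ℚ).den
    rw [show (1 / 2 : ℚ).den = 2 by norm_num]
    decide
  -- The coset of `1 / 2` is dense and lies in the complement.
  refine ((Homeomorph.addLeft (1 / 2 : ℚ)).surjective.denseRange.dense_image
    (Homeomorph.addLeft (1 / 2 : ℚ)).continuous dense_oddDenominators).mono ?_
  rintro _ ⟨r, hr, rfl⟩ hmem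
  exact h2 ((oddDenominators.add_mem_cancel_right hr).1 hmem)

/-- There are uncountably many pairwise disjoint dense subsets of the unit interval. -/
theorem exists_dense_disjoint_family {X : Type} (hX : Cardinal.mk X ≤ Cardinal.aleph 1) :
    ∃ D : X → Set unitInterval, (∀ x, Dense (D x)) ∧ ∀ x y t, t ∈ D x → t ∈ D y → x = y := by
  -- The family consists of traces of cosets of `ℚ` in `ℝ`: each is dense, and there are uncountably
  -- many, hence at least `ℵ₁`.
  let Q : AddSubgroup ℝ := (algebraMap ℚ ℝ).toAddMonoidHom.range
  have hQ : Countable Q := (countable_range (algebraMap ℚ ℝ)).to_subtype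
  have hunc : ¬ Countable (ℝ ⧸ Q) := fun _ =>
    not_countable (α := ℝ)
      (AddSubgroup.addGroupEquivQuotientProdAddSubgroup (s := Q)).injective.countable
  have hle : Cardinal.mk X ≤ Cardinal.mk (ℝ ⧸ Q) := by
    refine hX.trans (Cardinal.aleph_one_le_iff.2 ?_)
    rwa [← not_le, Cardinal.mk_le_aleph0_iff]
  obtain ⟨j⟩ := hle
  refine ⟨fun x => {t | ((t : ℝ) : ℝ ⧸ Q) = j x}, fun x => ?_, fun x y t hx hy =>
    j.injective (hx.symm.trans hy)⟩
  obtain ⟨s, hs⟩ := QuotientAddGroup.mk_surjective (j x)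
  rw [dense_iff_inter_open]
  rintro U hU ⟨u, hu⟩
  obtain ⟨V, hV, rfl⟩ := isOpen_induced_iff.1 hU
  have hu' : (u : ℝ) ∈ closure (Ioo (0 : ℝ) 1) := by
    rw [closure_Ioo zero_ne_one]
    exact u.2
  have hne : (V ∩ Ioo (0 : ℝ) 1).Nonempty := mem_closure_iff.1 hu' V hV hu
  have hd : Dense ((fun r => s + r) '' range ((↑) : ℚ → ℝ)) :=
    (Homeomorph.addLeft s).surjective.denseRange.dense_image (Homeomorph.addLeft s).continuous
      Rat.denseRange_cast
  obtain ⟨_, ⟨htV, ht⟩, _, ⟨r, rfl⟩, rfl⟩ := hd.inter_open_nonempty _ (hV.inter isOpen_Ioo) hne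
  refine ⟨⟨s + r, ht.1.le, ht.2.le⟩, htV, ?_⟩
  change ((s + r : ℝ) : ℝ ⧸ Q) = j x
  rw [← hs, eq_comm, QuotientAddGroup.eq]
  exact ⟨r, by simp⟩

/-! ### The tree of finitely supported functions -/

/-- The well-ordered set of all countable ordinals, in the lowest universe. -/
abbrev CountableOrdinal : Type := (Ordinal.omega.{0} 1).ToType

/-- The finitely supported functions into `ℕ` that are defined on the final segments `[a, ω₁)`:
such a function is represented by `a` and its extension by zero. -/
def FinalSegmentFn : Type :=
  {p : CountableOrdinal × (CountableOrdinal →₀ ℕ) // ∀ w, p.2 w ≠ 0 → p.1 ≤ w}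

namespace FinalSegmentFn

/-- The least element of the domain. -/
def start (x : FinalSegmentFn) : CountableOrdinal := x.1.1

/-- The extension by zero. -/
def toFun (x : FinalSegmentFn) : CountableOrdinal →₀ ℕ := x.1.2

theorem le_of_toFun_ne_zero (x : FinalSegmentFn) {w : CountableOrdinal} (h : x.toFun w ≠ 0) : x.start ≤ w :=
  x.2 w h

theorem ext {x y : FinalSegmentFn} (h : x.start = y.start) (h' : x.toFun = y.toFun) : x = y :=
  Subtype.ext (Prod.ext h h')

/-- `x ≤ y` if `y` is a restriction of `x`. -/
instance : PartialOrder FinalSegmentFn where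
  le x y := x.start ≤ y.start ∧ ∀ w, y.start ≤ w → x.toFun w = y.toFun w
  le_refl x := ⟨le_rfl, fun _ _ => rfl⟩
  le_trans x y z hxy hyz := ⟨hxy.1.trans hyz.1, fun w hw =>
    (hxy.2 w (hyz.1.trans hw)).trans (hyz.2 w hw)⟩
  le_antisymm x y hxy hyx := by
    have h : x.start = y.start := le_antisymm hxy.1 hyx.1
    refine ext h (Finsupp.ext fun w => ?_)
    by_cases hw : y.start ≤ w
    · exact hxy.2 w hw
    · rw [not_ne_iff.1 (mt y.le_of_toFun_ne_zero hw),
        not_ne_iff.1 (mt x.le_of_toFun_ne_zero (h ▸ hw))]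

/-- The level of a function is the first point of its domain. -/
noncomputable def level (x : FinalSegmentFn) : Ordinal.{0} := (Ordinal.ToType.mk.symm x.start).1

theorem level_lt (x : FinalSegmentFn) : x.level < Ordinal.omega 1 :=
  (Ordinal.ToType.mk.symm x.start).2

theorem level_le_level {x y : FinalSegmentFn} : x.level ≤ y.level ↔ x.start ≤ y.start :=
  (Ordinal.ToType.mk.symm).le_iff_le (x := x.start) (y := y.start)

theorem level_lt_level {x y : FinalSegmentFn} : x.level < y.level ↔ x.start < y.start :=
  (Ordinal.ToType.mk.symm).lt_iff_lt (x := x.start) (y := y.start)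

theorem exists_level {α : Ordinal.{0}} (hα : α < Ordinal.omega 1) :
    ∃ a : CountableOrdinal, ∀ x : FinalSegmentFn, x.level = α ↔ x.start = a := by
  refine ⟨Ordinal.ToType.mk ⟨α, hα⟩, fun x => ?_⟩
  rw [← OrderIso.symm_apply_eq, Subtype.ext_iff]
  rfl

theorem strictMono_level : StrictMono level := fun x y h => by
  rw [level_lt_level]
  exact lt_of_le_of_ne h.le.1 fun he => h.ne (le_antisymm h.le ⟨he.ge, fun w hw =>
    (h.le.2 w (he ▸ hw)).symm⟩)

theorem existsUnique_above (x : FinalSegmentFn) (α : Ordinal.{0}) (hα : α < Ordinal.omega 1)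
    (hx : x.level ≤ α) : ∃! y, x ≤ y ∧ y.level = α := by
  obtain ⟨a, ha⟩ := exists_level hα
  let y : FinalSegmentFn := ⟨(a, x.toFun.filter (a ≤ ·)), fun w hw => by
    by_contra h
    exact hw (Finsupp.filter_apply_neg _ _ h)⟩
  have hy : y.level = α := (ha y).2 rfl
  refine ⟨y, ⟨⟨level_le_level.1 (hx.trans hy.ge), fun w hw => ?_⟩, hy⟩, ?_⟩
  · exact (Finsupp.filter_apply_pos _ _ hw).symm
  · rintro z ⟨hxz, hz⟩
    have hza := (ha z).1 hz
    refine ext hza (Finsupp.ext fun w => ?_)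
    by_cases hw : a ≤ w
    · exact (hxz.2 w (hza ▸ hw)).symm.trans (Finsupp.filter_apply_pos (a ≤ ·) x.toFun hw).symm
    · exact (not_ne_iff.1 (mt z.le_of_toFun_ne_zero (hza ▸ hw))).trans
        (Finsupp.filter_apply_neg (a ≤ ·) x.toFun hw).symm

/-- Below every point there are points on each lower level with any given first value. -/
theorem exists_lt (x : FinalSegmentFn) {β : Ordinal.{0}} (hβ : β < x.level) (n : ℕ) :
    ∃ y < x, y.level = β ∧ y.toFun y.start = n := by
  obtain ⟨b, hb⟩ := exists_level (hβ.trans x.level_lt)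
  classical
  let g : CountableOrdinal →₀ ℕ := x.toFun.update b n
  have hg : ∀ w, b ≠ w → g w = x.toFun w := fun w hw => by
    simp [g, Function.update_of_ne hw.symm]
  have hbx : b < x.start := by
    let z : FinalSegmentFn := ⟨(b, 0), fun w hw => absurd rfl hw⟩
    rw [← show z.level = β from (hb z).2 rfl, level_lt_level] at hβ
    exact hβ
  let y : FinalSegmentFn := ⟨(b, g), fun w hw => by
    by_cases h : b = w
    · exact h.le
    · exact hbx.le.trans (x.le_of_toFun_ne_zero (hg w h ▸ hw))⟩
  have hyx : y ≤ x := ⟨hbx.le, fun w hw => hg w (hbx.trans_le hw).ne⟩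
  refine ⟨y, lt_of_le_of_ne hyx fun h => hbx.ne (congrArg start h), (hb y).2 rfl, ?_⟩
  change g b = n
  simp [g]

theorem exists_level_eq {β : Ordinal.{0}} (hβ : β < Ordinal.omega 1) (n : ℕ) :
    ∃ y : FinalSegmentFn, y.level = β ∧ y.toFun y.start = n := by
  obtain ⟨b, hb⟩ := exists_level hβ
  let y : FinalSegmentFn := ⟨(b, Finsupp.single b n), fun w hw => by
    by_contra h
    exact hw (Finsupp.single_eq_of_ne (by rintro rfl; exact h le_rfl))⟩
  exact ⟨y, (hb y).2 rfl, Finsupp.single_eq_same⟩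

theorem mk_le : Cardinal.mk FinalSegmentFn ≤ Cardinal.aleph 1 := by
  have hW : Cardinal.mk CountableOrdinal = Cardinal.aleph 1 := by
    rw [Cardinal.mk_toType, Ordinal.card_omega]
  have : Nonempty CountableOrdinal := Cardinal.mk_ne_zero_iff.1 (hW ▸ (Cardinal.aleph_pos 1).ne')
  refine (Cardinal.mk_subtype_le _).trans ?_
  rw [Cardinal.mk_prod, Cardinal.mk_finsupp_nat, hW]
  simp [Cardinal.aleph0_le_aleph]

/-- The first value of `x` selects the basic open set that receives `q x`, which gives the density
conditions since first values can be prescribed. Second coordinates from disjoint sets `D x` give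
injectivity; the rational coordinate stays free to encode parity. -/
theorem exists_labelling : ∃ q : FinalSegmentFn → ℚ × unitInterval, Function.Injective q ∧
    (∀ x, (q x).1 ∈ oddDenominators ↔ x.level % 2 = 0) ∧
    ∀ V : Set (ℚ × unitInterval), IsOpen V → V.Nonempty → ∃ n, ∀ x, x.toFun x.start = n →
      q x ∈ V := by
  obtain ⟨D, hD, hdisj⟩ := exists_dense_disjoint_family mk_le
  obtain ⟨b, hbc, hbe, hb⟩ := TopologicalSpace.exists_countable_basis (ℚ × unitInterval)
  have hbne : b.Nonempty := by
    obtain ⟨v, hv, -⟩ := hb.exists_subset_of_mem_open (mem_univ ((0 : ℚ), (0 : unitInterval)))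
      isOpen_univ
    exact ⟨v, hv⟩
  obtain ⟨B, rfl⟩ := hbc.exists_eq_range hbne
  have hex : ∀ x : FinalSegmentFn, ∃ p : ℚ × unitInterval, p ∈ B (x.toFun x.start) ∧
      p.2 ∈ D x ∧ (p.1 ∈ oddDenominators ↔ x.level % 2 = 0) := by
    intro x
    have hBo := hb.isOpen (mem_range_self (x.toFun x.start))
    have hBn : (B (x.toFun x.start)).Nonempty :=
      nonempty_iff_ne_empty.2 fun h => hbe ⟨_, h⟩
    by_cases h : x.level % 2 = 0
    · obtain ⟨p, hp, hp1, hp2⟩ :=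
        (dense_oddDenominators.prod (hD x)).inter_open_nonempty _ hBo hBn
      exact ⟨p, hp, hp2, iff_of_true hp1 h⟩
    · obtain ⟨p, hp, hp1, hp2⟩ :=
        (dense_compl_oddDenominators.prod (hD x)).inter_open_nonempty _ hBo hBn
      exact ⟨p, hp, hp2, iff_of_false hp1 h⟩
  choose q hqB hqD hq using hex
  refine ⟨q, fun x y h => hdisj x y (q x).2 (hqD x) (h ▸ hqD y), hq, fun V hV ⟨v, hv⟩ => ?_⟩
  obtain ⟨_, ⟨n, rfl⟩, -, hn⟩ := hb.exists_subset_of_mem_open hv hV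
  exact ⟨n, fun x hx => hn (hx ▸ hqB x)⟩

end FinalSegmentFn

/-! ### The tree topology as a subspace of a product -/

section TreeTopology

variable {X Z : Type*} [PartialOrder X]

open Classical in
/-- A labelling together with the indicator functions of the cones. -/
noncomputable def coneMap (q : X → Z) (x : X) : Z × (X → Bool) := (q x, fun y => decide (x ≤ y))

theorem injective_coneMap {q : X → Z} (hq : Function.Injective q) :
    Function.Injective (coneMap q) := fun _ _ h => hq (congrArg Prod.fst h)

/-- If the points above each point form a chain, then the topology induced by a labelling and by
the cones has the neighbourhood bases of a tree topology. -/
theorem nhds_induced_coneMap_hasBasis [TopologicalSpace Z] (q : X → Z)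
    (hchain : ∀ w x y : X, w ≤ x → w ≤ y → x ≤ y ∨ y ≤ x) (x : X) :
    (@nhds X (TopologicalSpace.induced (coneMap q) inferInstance) x).HasBasis
      (fun s : Set Z × Set X => IsOpen s.1 ∧ q x ∈ s.1 ∧ s.2.Finite ∧ s.2 ⊆ Iio x)
      (fun s => q ⁻¹' s.1 ∩ (Iic x \ ⋃ y ∈ s.2, Iic y)) := by
  classical
  rw [nhds_induced, nhds_prod_eq, nhds_pi]
  have hpi := hasBasis_pi (ι := X) (α := fun _ => Bool)
    (f := fun y => 𝓝 ((coneMap q x).2 y)) (ι' := fun _ => Unit) (p := fun _ _ => True)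
    (s := fun y _ => {(coneMap q x).2 y}) fun y => by
      rw [nhds_discrete]
      exact hasBasis_pure _
  refine (((nhds_basis_opens (coneMap q x).1).prod hpi).comap (coneMap q)).to_hasBasis ?_ ?_
  · rintro ⟨V, I, _⟩ ⟨⟨hxV, hV⟩, hI, -⟩
    -- Only `y < x` need removing: for `z ≤ x`, the chain condition gives `z ≤ y ↔ x ≤ y` once `z`
    -- avoids those cones.
    refine ⟨(V, {y ∈ I | y < x}), ⟨hV, hxV, hI.subset fun _ h => h.1, fun _ h => h.2⟩, ?_⟩
    rintro z ⟨hzV, hzx, hz⟩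
    refine ⟨hzV, fun y hy => ?_⟩
    change decide (z ≤ y) = decide (x ≤ y)
    rw [decide_eq_decide]
    refine ⟨fun hzy => ?_, fun hxy => le_trans hzx hxy⟩
    by_contra hxy
    have hyx : y < x := lt_of_le_not_ge ((hchain z x y hzx hzy).resolve_left hxy) hxy
    exact hz (mem_iUnion₂.2 ⟨y, ⟨hy, hyx⟩, hzy⟩)
  · rintro ⟨V, Y⟩ ⟨hV, hxV, hY, hYx⟩
    refine ⟨(V, insert x Y, fun _ => ()), ⟨⟨hxV, hV⟩, hY.insert x, fun _ _ => trivial⟩, ?_⟩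
    rintro z ⟨hzV, hz⟩
    have hz' : ∀ y ∈ insert x Y, (z ≤ y ↔ x ≤ y) := fun y hy => by
      have : decide (z ≤ y) = decide (x ≤ y) := hz y hy
      rwa [decide_eq_decide] at this
    refine ⟨hzV, (hz' x (mem_insert _ _)).2 le_rfl, fun hzY => ?_⟩
    obtain ⟨y, hy, hzy⟩ := mem_iUnion₂.1 hzY
    exact (hYx hy).not_ge ((hz' y (mem_insert_of_mem _ hy)).1 hzy)

theorem t35Space_induced_coneMap [TopologicalSpace Z] [T35Space Z] {q : X → Z}
    (hq : Function.Injective q) :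
    @T35Space X (TopologicalSpace.induced (coneMap q) inferInstance) := by
  let _ : TopologicalSpace X := TopologicalSpace.induced (coneMap q) inferInstance
  exact IsEmbedding.t35Space (f := coneMap q) ⟨⟨rfl⟩, injective_coneMap hq⟩

theorem continuous_induced_coneMap [TopologicalSpace Z] (q : X → Z) :
    @Continuous X Z (TopologicalSpace.induced (coneMap q) inferInstance) _ q := by
  let _ : TopologicalSpace X := TopologicalSpace.induced (coneMap q) inferInstance
  exact continuous_fst.comp (continuous_induced_dom (f := coneMap q))

end TreeTopology

/-! ### Assembly of the example -/

theorem mainTheorem2 :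
    ∃ (X : Type) (_ : TopologicalSpace X) (_ : PartialOrder X)
      (level : X → Ordinal.{0}) (q : X → ℚ × unitInterval) (f : X → unitInterval),
      T35Space X ∧ IsScattered X ∧ IsHereditarilyBaire X ∧
      IsLevelTree X level q ∧
      (∀ x, (f x : ℝ) = Set.indicator {z | level z % 2 = 0} (fun _ => (1 : ℝ)) x) ∧
      IsBaireOne f ∧
      ¬ IsFunctionallyCountablyFragmented f ∧
      ¬ ∃ g : StoneCech X → ℝ, IsBaireOne g ∧ ∀ x, g (stoneCechUnit x) = (f x : ℝ) := by
  classical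
  obtain ⟨q, hinj, hpar, hq⟩ := FinalSegmentFn.exists_labelling
  let t : TopologicalSpace FinalSegmentFn :=
    TopologicalSpace.induced (coneMap q) inferInstance
  have hchain : ∀ w x y : FinalSegmentFn, w ≤ x → w ≤ y → x ≤ y ∨ y ≤ x := fun w x y hx hy => by
    rcases le_total x.start y.start with h | h
    · exact Or.inl ⟨h, fun v hv => (hx.2 v (h.trans hv)).symm.trans (hy.2 v hv)⟩
    · exact Or.inr ⟨h, fun v hv => (hy.2 v (h.trans hv)).symm.trans (hx.2 v hv)⟩
  have htree : IsLevelTree FinalSegmentFn FinalSegmentFn.level q :=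
    { level_lt := FinalSegmentFn.level_lt
      injective := hinj
      dense_level := fun α hα => dense_iff_inter_open.2 fun V hV hne => by
        obtain ⟨n, hn⟩ := hq V hV hne
        obtain ⟨y, hy, hyn⟩ := FinalSegmentFn.exists_level_eq hα n
        exact ⟨q y, hn y hyn, y, hy, rfl⟩
      strictMono := FinalSegmentFn.strictMono_level
      existsUnique_above := FinalSegmentFn.existsUnique_above
      dense_below := fun x β hβ => dense_iff_inter_open.2 fun V hV hne => by
        obtain ⟨n, hn⟩ := hq V hV hne
        obtain ⟨y, hyx, hy, hyn⟩ := x.exists_lt hβ n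
        exact ⟨q y, hn y hyn, y, ⟨hyx, hy⟩, rfl⟩
      nhds_basis := nhds_induced_coneMap_hasBasis q hchain }
  let h : ℚ → unitInterval := fun r => if r ∈ oddDenominators then 1 else 0
  have hf : ∀ x, ((h (q x).1 : unitInterval) : ℝ) =
      indicator {z : FinalSegmentFn | z.level % 2 = 0} (fun _ => (1 : ℝ)) x := by
    intro x
    by_cases hx : x.level % 2 = 0
    · rw [indicator_of_mem (by exact hx)]
      simp [h, (hpar x).2 hx]
    · rw [indicator_of_notMem (by exact hx)]
      simp [h, mt (hpar x).1 hx]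
  exact ⟨FinalSegmentFn, t, inferInstance, FinalSegmentFn.level, q, fun x => h (q x).1,
    t35Space_induced_coneMap hinj, htree.isScattered, htree.isScattered.isHereditarilyBaire,
    htree, hf,
    (Rat.isBaireOne h).comp_continuous (continuous_fst.comp (continuous_induced_coneMap q)),
    htree.not_isFunctionallyCountablyFragmented hf, htree.not_exists_extension hf⟩
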